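/- Let $F$ be a field and let $S\subset\mathbb Z$ be a finite step set. Put $A=S\cap\{0,1,2,\dots\}$ and $B=-(S\setminus A)$, let $\alpha=\max A$ and $\beta=\max B$, and assume $\alpha\ge1$ and $\beta\ge 1$. Give the step $a\in A$ the weight $p_a\in F$ and the step $-b$, $b\in B$, the weight $q_b\in F$, with $p_\alpha\ne0$ and $q_\beta\ne0$. For $w\ge0$ and $0\le u,v\le w$ let $$G^{w,\alpha,\beta}_{(u,v)}(t)=\sum_{n\ge0}t^n\sum_{\varphi}\omega_\varphi\in F[[t]],$$ where $\varphi$ runs over the $n$-step directed paths in the slit $\mathbb Z\times\{0,1,\dots,w\}$ from $(0,u)$ to $(n,v)$ with steps in $\{1\}\times S$, and $\omega_\varphi$ is the product of the weights of the steps of $\varphi$. Let $L$ be a field containing $F[[t]]$ that contains all $\alpha+\beta$ roots $\bar z=(z_1,\dots,z_{\alpha+\beta})$, listed with multiplicity, of the kernel $$K(t,z)=1-t\sum_{a\in A}p_az^a-t\sum_{b\in B}q_bz^{-b}$$ as a function of $z$. For a partition $\lambda=(\lambda_1\ge\dots\ge\lambda_n\ge0)$ let $s_\lambda(x_1,\dots,x_n)=\det(x_j^{\lambda_i+n-i})/\det(x_j^{n-i})$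 be the Schur polynomial, and write $x_+=\max(x,0)$. Then $s_{((w+1)^\alpha,0^\beta)}(\bar z)\neq0$ and, in $L$, $$G^{w,\alpha,\beta}_{(u,v)}(t)=\frac{(-1)^{1-\alpha}}{t\,p_\alpha}\;\frac{\sum_{l=0}^{r}s_{(w^{\alpha-1},\,w-(v-u)_+-l,\,(u-v)_++l,\,0^{\beta-1})}(\bar z)}{s_{((w+1)^\alpha,0^\beta)}(\bar z)},\qquad r=\min(u,v,w-u,w-v).$$ -/

import Mathlib

/-! ### Schur polynomials in finitely many variables -/

/-- The alternant `det (X_j ^ (μ_i + n - i))`, `1 ≤ i, j ≤ n`, in the `n` variables `X_j`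
(with indices starting at `0` the exponent is `μ_i + (n - 1 - i)`). -/
noncomputable def alternant {n : ℕ} (μ : Fin n → ℕ) : MvPolynomial (Fin n) ℤ :=
  Matrix.det (Matrix.of fun i j : Fin n =>
    (MvPolynomial.X j : MvPolynomial (Fin n) ℤ) ^ (μ i + (n - 1 - (i : ℕ))))

theorem X_sub_X_dvd_alternant {n : ℕ} (μ : Fin n → ℕ) {i j : Fin n} (hij : i ≠ j) :
    (MvPolynomial.X j - MvPolynomial.X i : MvPolynomial (Fin n) ℤ) ∣ alternant μ := by
  rw [← Ideal.mem_span_singleton, ← Ideal.Quotient.eq_zero_iff_mem, alternant, RingHom.map_det]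
  refine Matrix.det_zero_of_column_eq hij fun k => ?_
  have h : Ideal.Quotient.mk (Ideal.span {(MvPolynomial.X j - MvPolynomial.X i :
      MvPolynomial (Fin n) ℤ)}) (MvPolynomial.X i) =
      Ideal.Quotient.mk _ (MvPolynomial.X j) := by
    rw [eq_comm, Ideal.Quotient.eq]
    exact Ideal.mem_span_singleton_self _
  simp [h]

theorem X_sub_X_irreducible {n : ℕ} {i j : Fin n} (hij : i ≠ j) :
    Irreducible (MvPolynomial.X j - MvPolynomial.X i : MvPolynomial (Fin n) ℤ) := by
  have h := MvPolynomial.irreducible_mul_X_add (1 : MvPolynomial (Fin n) ℤ) (-MvPolynomial.X i) j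
    one_ne_zero (by simp) (by simp [MvPolynomial.vars_neg, MvPolynomial.vars_X, hij.symm])
    isRelPrime_one_left
  simpa [sub_eq_add_neg] using h

theorem X_sub_X_not_dvd {n : ℕ} {i j k l : Fin n} (hij : i < j) (hkl : k < l)
    (hne : (i, j) ≠ (k, l)) :
    ¬ ((MvPolynomial.X j - MvPolynomial.X i : MvPolynomial (Fin n) ℤ) ∣
      MvPolynomial.X l - MvPolynomial.X k) := by
  rintro ⟨c, hc⟩
  have key : ∀ f : Fin n → ℤ, f i = f j → f k = f l := fun f hf => by
    have := congrArg (MvPolynomial.eval f) hc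
    simp only [map_sub, MvPolynomial.eval_X, map_mul, hf, sub_self, zero_mul] at this
    linarith
  have h1 := key (fun m => if m = k then 1 else 0)
  have h2 := key (fun m => if m = l then 1 else 0)
  simp only [Prod.mk.injEq, ne_eq] at hne
  grind

theorem alternant_zero_eq {n : ℕ} : alternant (0 : Fin n → ℕ) =
    ((Equiv.Perm.sign (Fin.revPerm : Equiv.Perm (Fin n)) : ℤ) : MvPolynomial (Fin n) ℤ) *
      (Matrix.vandermonde (MvPolynomial.X : Fin n → MvPolynomial (Fin n) ℤ)).det := by
  rw [← Matrix.det_transpose, ← Matrix.det_permute, alternant]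
  congr 1
  ext1 i j
  simp [Matrix.vandermonde_apply, Fin.val_rev, Nat.sub_sub, Nat.add_comm]

theorem alternant_zero_dvd {n : ℕ} (μ : Fin n → ℕ) :
    alternant (0 : Fin n → ℕ) ∣ alternant μ := by
  have hu : IsUnit ((Equiv.Perm.sign (Fin.revPerm : Equiv.Perm (Fin n)) : ℤ) :
      MvPolynomial (Fin n) ℤ) :=
    (Units.isUnit _).map (Int.castRingHom (MvPolynomial (Fin n) ℤ))
  rw [alternant_zero_eq, hu.mul_left_dvd, Matrix.det_vandermonde, Finset.prod_sigma']
  refine Finset.prod_dvd_of_isRelPrime ?_ ?_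
  · rintro ⟨i, j⟩ hij ⟨k, l⟩ hkl hne
    simp only [Finset.coe_sigma, Set.mem_sigma_iff, Finset.mem_coe, Finset.mem_univ,
      Finset.mem_Ioi, true_and] at hij hkl
    refine ((X_sub_X_irreducible hij.ne).isRelPrime_iff_not_dvd).2
      (X_sub_X_not_dvd hij hkl fun h => hne ?_)
    simp only [Prod.mk.injEq] at h
    simp [h.1, h.2]
  · rintro ⟨i, j⟩ hij
    simp only [Finset.mem_sigma, Finset.mem_univ, Finset.mem_Ioi, true_and] at hij
    exact X_sub_X_dvd_alternant μ hij.ne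

theorem alternant_zero_ne_zero {n : ℕ} : alternant (0 : Fin n → ℕ) ≠ 0 := by
  rw [alternant_zero_eq]
  refine mul_ne_zero (Int.cast_ne_zero.2 (Units.ne_zero _)) ?_
  exact Matrix.det_vandermonde_ne_zero_iff.2 (MvPolynomial.X_injective (R := ℤ))

/-- The Schur polynomial `s_μ(X_1, …, X_n)` of a partition `μ = (μ_1 ≥ … ≥ μ_n ≥ 0)` written with
`n` parts, some of which may be zero: the quotient of alternants
`det (X_j ^ (μ_i + n - i)) / det (X_j ^ (n - i))`, a polynomial with integer coefficients. -/
noncomputable def schurPoly {n : ℕ} (μ : Fin n → ℕ) : MvPolynomial (Fin n) ℤ :=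
  Classical.choose (alternant_zero_dvd μ)

/-- The defining property of the Schur polynomial; it determines `schurPoly μ`, because
`alternant 0` is a nonzero element of an integral domain. -/
theorem alternant_zero_mul_schurPoly {n : ℕ} (μ : Fin n → ℕ) :
    alternant (0 : Fin n → ℕ) * schurPoly μ = alternant μ :=
  (Classical.choose_spec (alternant_zero_dvd μ)).symm

/-! ### Weighted directed paths in a slit -/

/-- The up steps `A = S ∩ {0, 1, 2, …}` of a step set `S`; a horizontal step belongs to `A`. -/
def upSteps (S : Finset ℤ) : Finset ℕ := (S.filter fun s => 0 ≤ s).image Int.natAbs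

/-- The down steps `B = -(S \ A)` of a step set `S`. -/
def downSteps (S : Finset ℤ) : Finset ℕ := (S.filter fun s => s < 0).image Int.natAbs

/-- The weight of a step: `p a` for the step `a ≥ 0` and `q b` for the step `-b < 0`. -/
def stepWeight {F : Type*} (p q : ℕ → F) (s : ℤ) : F :=
  if 0 ≤ s then p s.natAbs else q s.natAbs

/-- The directed `n`-step paths in the slit `ℤ × {0, …, w}` from `(0, u)` to `(n, v)` with steps in
`{1} × S`; a path is given by its sequence of heights. -/
def slitPaths (S : Finset ℤ) (w u v n : ℕ) : Finset (Fin (n + 1) → Fin (w + 1)) :=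
  Finset.univ.filter fun h =>
    (h 0 : ℕ) = u ∧ (h (Fin.last n) : ℕ) = v ∧
      ∀ i : Fin n, ((h i.succ : ℕ) : ℤ) - ((h i.castSucc : ℕ) : ℤ) ∈ S

/-- The weight of a path: the product of the weights of its steps. -/
def pathWeight {F : Type*} [CommMonoid F] (p q : ℕ → F) {w n : ℕ}
    (h : Fin (n + 1) → Fin (w + 1)) : F :=
  ∏ i : Fin n, stepWeight p q (((h i.succ : ℕ) : ℤ) - ((h i.castSucc : ℕ) : ℤ))

/-- The generating function `G_{(u,v)}(t)` of the weighted directed paths, a formal power series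
in `t`. -/
noncomputable def slitGF {F : Type*} [Field F] (S : Finset ℤ) (p q : ℕ → F) (w u v : ℕ) :
    PowerSeries F :=
  PowerSeries.mk fun n => ∑ h ∈ slitPaths S w u v n, pathWeight p q h

/-! ### The kernel -/

/-- The kernel `K(t, z) = 1 - t ∑_{a ∈ A} p_a z ^ a - t ∑_{b ∈ B} q_b z ^ (-b)`. -/
noncomputable def kernelFun {L : Type*} [Field L] (S : Finset ℤ) (p q : ℕ → L) (t z : L) : L :=
  1 - t * ∑ a ∈ upSteps S, p a * z ^ a - t * ∑ b ∈ downSteps S, q b * z ^ (-(b : ℤ))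

/-- The polynomial `z ^ β K(t, z)` in `z`, where `β` is the largest element of `B`. -/
noncomputable def kernelPoly {L : Type*} [Field L] (S : Finset ℤ) (p q : ℕ → L) (β : ℕ) (t : L) :
    Polynomial L :=
  Polynomial.X ^ β
    - Polynomial.C t * ∑ a ∈ upSteps S, Polynomial.C (p a) * Polynomial.X ^ (a + β)
    - Polynomial.C t * ∑ b ∈ downSteps S, Polynomial.C (q b) * Polynomial.X ^ (β - b)

theorem eval_kernelPoly {L : Type*} [Field L] (S : Finset ℤ) (p q : ℕ → L) {β : ℕ}
    (hβ : ∀ b ∈ downSteps S, b ≤ β) (t : L) {z : L} (hz : z ≠ 0) :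
    (kernelPoly S p q β t).eval z = z ^ β * kernelFun S p q t z := by
  have h1 : ∑ a ∈ upSteps S, p a * z ^ (a + β) = z ^ β * ∑ a ∈ upSteps S, p a * z ^ a := by
    rw [Finset.mul_sum]
    exact Finset.sum_congr rfl fun a _ => by ring
  have h2 : ∑ b ∈ downSteps S, q b * z ^ (β - b) =
      z ^ β * ∑ b ∈ downSteps S, q b * z ^ (-(b : ℤ)) := by
    rw [Finset.mul_sum]
    refine Finset.sum_congr rfl fun b hb => ?_
    rw [pow_sub₀ z hz (hβ b hb), zpow_neg, zpow_natCast]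
    ring
  simp only [kernelPoly, kernelFun, Polynomial.eval_sub, Polynomial.eval_mul, Polynomial.eval_pow,
    Polynomial.eval_X, Polynomial.eval_C, Polynomial.eval_finsetSum, h1, h2]
  ring

/-- The family `z_1, …, z_{α+β}` lists the roots of the kernel `K(t, z)`, regarded as a function
of `z`, with their multiplicities. (The number `0` is not a root of `z ^ β K(t, z)`, because its
constant term is `-t q_β`, which is not zero.) -/
def IsKernelRoots {L : Type*} [Field L] (S : Finset ℤ) (p q : ℕ → L) (α β : ℕ) (t : L)
    (z : Fin (α + β) → L) : Prop :=
  (kernelPoly S p q β t).roots = Finset.univ.val.map z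

/-! ### The partitions -/

/-- The partition `(w ^ (α - 1), x, y, 0 ^ (β - 1))` with `α + β` parts. -/
def twoRowEnd (α β w x y : ℕ) (i : Fin (α + β)) : ℕ :=
  if (i : ℕ) + 1 < α then w else if (i : ℕ) + 1 = α then x else if (i : ℕ) = α then y else 0

/-- The partition `(w ^ α, 0 ^ β)` with `α + β` parts. -/
def rectPart (α β w : ℕ) (i : Fin (α + β)) : ℕ := if (i : ℕ) < α then w else 0

/-! The matrix `1 - tA` of the slit, with `A` the weighted adjacency matrix, is a band Toeplitz
matrix. Its entries are the coefficients of `z ^ β K(t, z)`, that is, `-t p_α` times those of `∏ (T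
- z_i)`. Splitting a path at its first step shows that the matrix of path generating functions
inverts `1 - tA`, so it suffices to check that the matrix of Schur sums does so up to a scalar.

Let `D a b` be the alternant of the numerator with exponents `a` and `b` in its two middle rows. It
is antisymmetric, vanishes when `a` repeats the exponent of another row, and satisfies the
recurrence with coefficients `∏ (T - X_i)` in `a`. Sums of `D` along an antidiagonal, over a fixed
range of `b`, therefore solve this recurrence, and the reflection exchanging `a` and `b` cancels
most of their terms. Two such solutions, glued together, satisfy the boundary conditions of the slit
at both ends and fail the recurrence at one place only, by a multiple of the alternant of `((w+1)^α,
0^β)`. This is `greenGlue`; `greenGlue_recurrence` and `greenGlue_eq_zero` give its properties, and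
`greenGlue_eq_sum` identifies it with the Schur sum.

All this takes place with indeterminates over `ℤ`, where the Vandermonde alternant can be cancelled,
so multiple roots need no separate treatment after specialization. Nonvanishing of the denominator
follows by induction on `w`, since the numerator at `u = v = w` is the denominator of the slit one
narrower. -/

/-! ### Green functions of a linear recurrence, built from an antisymmetric family. -/

theorem sum_reflect_eq_zero {R : Type*} [CommRing R] {D : ℤ → ℤ → R} (hD : ∀ a, D a a = 0)
    (hD' : ∀ a b, D a b = -D b a) (Q : Finset ℤ) (T : ℤ)
    (h : ∀ b ∈ Q, T - b ∈ Q ∨ D (T - b) b = 0) : ∑ b ∈ Q, D (T - b) b = 0 := by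
  rw [← Finset.sum_filter_of_ne (p := fun b => T - b ∈ Q)
    (fun b hb hne => (h b hb).resolve_right hne)]
  -- The fixed point `b = T - b` is where `D a a = 0` is needed; antisymmetry alone does not give it
  -- in characteristic 2.
  refine Finset.sum_involution (fun b _ => T - b) (fun b _ => ?_) (fun b _ hne heq => ?_)
    (fun b hb => ?_) (fun b _ => ?_)
  · rw [hD' (T - b) b]; simp
  · exact hne (by rw [heq]; exact hD b)
  · simp only [Finset.mem_filter] at hb ⊢
    exact ⟨hb.2, by simpa using hb.1⟩
  · simp

/-- The sum of the entries of the two-index family `D` with second index in `[lo, hi)` on the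
antidiagonal `a + b = c + U`. -/
noncomputable def antidiagSum {R : Type*} [CommRing R] (D : ℤ → ℤ → R) (c lo hi U : ℤ) : R :=
  ∑ b ∈ Finset.Ico lo hi, D (c + U - b) b

theorem antidiagSum_recurrence {R : Type*} [CommRing R] {D : ℤ → ℤ → R} {n : ℕ} {k : ℕ → R}
    (hrec : ∀ a b, 0 ≤ a → ∑ j ∈ Finset.range (n + 1), k j * D (a + j) b = 0)
    {c lo hi u : ℤ} (h : hi ≤ c + u + 1) :
    ∑ j ∈ Finset.range (n + 1), k j * antidiagSum D c lo hi (u + j) = 0 := by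
  simp only [antidiagSum, Finset.mul_sum]
  rw [Finset.sum_comm]
  refine Finset.sum_eq_zero fun b hb => ?_
  rw [Finset.mem_Ico] at hb
  rw [← hrec (c + u - b) b (by omega)]
  refine Finset.sum_congr rfl fun j _ => ?_
  congr 2
  ring

/-- The discrete Green function with pole at `v + E + 1`, glued from two solutions of the linear
recurrence. -/
noncomputable def greenGlue {R : Type*} [CommRing R] (D : ℤ → ℤ → R) (E w v U : ℤ) : R :=
  if U ≤ v + E + 1 then antidiagSum D (w - v + E) E (w - v + E + 1) U
  else -antidiagSum D (w - v + E) (w - v + E + 1) (w + E + 2) U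

section
variable {R : Type*} [CommRing R] {D : ℤ → ℤ → R} {n : ℕ} {E w v : ℤ}

/-- These are the `n - 1` boundary conditions: for `n = α + β` and `E = β - 1`, `β` zeros below the
slit and `α` above, up to a shift by `β`. In each branch a term either has its mirror image inside
the range of summation or has its first index in a gap where `D` vanishes. -/
theorem greenGlue_eq_zero (hD : ∀ a, D a a = 0) (hD' : ∀ a b, D a b = -D b a)
    (hlo : ∀ a b, 0 ≤ a → a < E → D a b = 0)
    (hhi : ∀ a b, w + E + 1 < a → a < w + n → D a b = 0)
    (hv : 0 ≤ v) (hvw : v ≤ w) {U : ℤ}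
    (hU : (0 ≤ U ∧ U ≤ E) ∨ (w + E + 1 < U ∧ U ≤ w + n)) : greenGlue D E w v U = 0 := by
  unfold greenGlue antidiagSum
  split_ifs with h
  · refine sum_reflect_eq_zero hD hD' _ _ fun b hb => ?_
    rw [Finset.mem_Ico] at hb ⊢
    by_cases h1 : w - v + E + U - b < E
    · exact Or.inr (hlo _ _ (by omega) h1)
    · left; omega
  · rw [neg_eq_zero]
    refine sum_reflect_eq_zero hD hD' _ _ fun b hb => ?_
    rw [Finset.mem_Ico] at hb ⊢
    by_cases h1 : w + E + 1 < w - v + E + U - b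
    · exact Or.inr (hhi _ _ h1 (by omega))
    · left; omega

/-- This makes the two branches of `greenGlue` agree for `v < U < v + n`, so the recurrence survives
across the cut. -/
theorem antidiagSum_full_eq_zero (hD : ∀ a, D a a = 0) (hD' : ∀ a b, D a b = -D b a)
    (hlo : ∀ a b, 0 ≤ a → a < E → D a b = 0)
    (hhi : ∀ a b, w + E + 1 < a → a < w + n → D a b = 0) {U : ℤ}
    (hU : v < U) (hU' : U < v + n) :
    antidiagSum D (w - v + E) E (w + E + 2) U = 0 := by
  refine sum_reflect_eq_zero hD hD' _ _ fun b hb => ?_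
  rw [Finset.mem_Ico] at hb ⊢
  by_cases h1 : w - v + E + U - b < E
  · exact Or.inr (hlo _ _ (by omega) h1)
  by_cases h2 : w + E + 1 < w - v + E + U - b
  · exact Or.inr (hhi _ _ h2 (by omega))
  · left; omega

/-- At `U = v + n` the term `b = E` has first index `w + n`, just past the upper gap, and is the
only one to survive the reflection. -/
theorem antidiagSum_full_pole (hD : ∀ a, D a a = 0) (hD' : ∀ a b, D a b = -D b a)
    (hhi : ∀ a b, w + E + 1 < a → a < w + n → D a b = 0)
    (hw : 0 ≤ w) (hn : E + 2 ≤ n) :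
    antidiagSum D (w - v + E) E (w + E + 2) (v + n) = D (w + n) E := by
  unfold antidiagSum
  have h0 : E ∈ Finset.Ico E (w + E + 2) := by rw [Finset.mem_Ico]; omega
  rw [← Finset.add_sum_erase _ _ h0]
  rw [sum_reflect_eq_zero hD hD' _ _ fun b hb => ?_, add_zero]
  · congr 1; ring
  · simp only [Finset.mem_erase, Finset.mem_Ico] at hb ⊢
    by_cases h2 : w + E + 1 < w - v + E + (v + n) - b
    · exact Or.inr (hhi _ _ h2 (by omega))
    · left; omega

/-- Each window of `n + 1` values lies in the domain of one solution, thanks to the overlap of the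
branches. For `u = v` alone the last value, at `v + n`, falls outside the overlap, and the mismatch
there is the pole. -/
theorem greenGlue_recurrence {k : ℕ → R} (hD : ∀ a, D a a = 0) (hD' : ∀ a b, D a b = -D b a)
    (hlo : ∀ a b, 0 ≤ a → a < E → D a b = 0)
    (hhi : ∀ a b, w + E + 1 < a → a < w + n → D a b = 0)
    (hrec : ∀ a b, 0 ≤ a → ∑ j ∈ Finset.range (n + 1), k j * D (a + j) b = 0)
    (hk : k n = 1) (hE : 0 ≤ E) (hv : 0 ≤ v) (hvw : v ≤ w) (hn : E + 2 ≤ n) {u : ℤ} (hu : 0 ≤ u) :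
    ∑ j ∈ Finset.range (n + 1), k j * greenGlue D E w v (u + j) =
      if u = v then D E (w + n) else 0 := by
  have key : ∀ U, antidiagSum D (w - v + E) E (w + E + 2) U =
      antidiagSum D (w - v + E) E (w - v + E + 1) U +
      antidiagSum D (w - v + E) (w - v + E + 1) (w + E + 2) U := fun U => by
    unfold antidiagSum
    rw [← Finset.sum_union (Finset.Ico_disjoint_Ico_consecutive _ _ _),
      Finset.Ico_union_Ico_eq_Ico (by omega) (by omega)]
  have full := fun U (h1 : v < U) (h2 : U < v + n) =>
    (antidiagSum_full_eq_zero hD hD' hlo hhi h1 h2)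
  rcases lt_or_ge v u with huv | huv
  · have h0 := neg_eq_zero.2 (antidiagSum_recurrence hrec (c := w - v + E)
      (lo := w - v + E + 1) (hi := w + E + 2) (u := u) (by omega))
    rw [if_neg (by omega), ← h0, ← Finset.sum_neg_distrib]
    refine Finset.sum_congr rfl fun j hj => ?_
    rw [Finset.mem_range] at hj
    unfold greenGlue
    split_ifs with h
    · have := key (u + j)
      rw [full _ (by omega) (by omega)] at this
      rw [eq_neg_of_add_eq_zero_left this.symm]; ring
    · ring
  · have h0 := antidiagSum_recurrence hrec (c := w - v + E)
      (lo := E) (hi := w - v + E + 1) (u := u) (by omega)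
    have hlow : ∀ j ∈ Finset.range n, k j * greenGlue D E w v (u + j) =
        k j * antidiagSum D (w - v + E) E (w - v + E + 1) (u + j) := fun j hj => by
      rw [Finset.mem_range] at hj
      unfold greenGlue
      split_ifs with h
      · rfl
      · have := key (u + j)
        rw [full _ (by omega) (by omega)] at this
        rw [eq_neg_of_add_eq_zero_left this.symm]
    rw [Finset.sum_range_succ] at h0
    rw [Finset.sum_range_succ, Finset.sum_congr rfl hlow, eq_neg_of_add_eq_zero_left h0, hk]
    unfold greenGlue
    split_ifs with h h1 h1
    · omega
    · simp
    · subst h1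
      have := key (u + n)
      rw [antidiagSum_full_pole hD hD' hhi (by omega) hn] at this
      rw [hD' E, this]; ring
    · have := key (u + n)
      rw [full _ (by omega) (by omega)] at this
      rw [eq_neg_of_add_eq_zero_left this.symm]; ring

/-- A closed form of the Green function as a sum over nested two-row shapes. -/
theorem greenGlue_eq_sum (hD : ∀ a, D a a = 0) (hD' : ∀ a b, D a b = -D b a)
    {e w v x : ℕ} (hv : v ≤ w) (hx : x ≤ w) :
    greenGlue D e w v (x + e + 1) =
      ∑ l ∈ Finset.range (min (min x v) (min (w - x) (w - v)) + 1),
        D ((w - (v - x) - l + (e + 1) : ℕ)) (((x - v) + l + e : ℕ)) := by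
  set r := min (min x v) (min (w - x) (w - v)) with hr
  have hsum : ∑ l ∈ Finset.range (r + 1),
        D ((w - (v - x) - l + (e + 1) : ℕ)) (((x - v) + l + e : ℕ)) =
      ∑ b ∈ Finset.Ico (((x - v) + e : ℕ) : ℤ) ((x - v) + e + r + 1 : ℕ),
        D ((w : ℤ) - v + e + (x + e + 1) - b) b := by
    refine Finset.sum_bij (fun l _ => (((x - v) + l + e : ℕ) : ℤ)) ?_ ?_ ?_ ?_
    · intro l hl
      rw [Finset.mem_range] at hl
      rw [Finset.mem_Ico]; omega
    · intro a _ b _ h; omega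
    · intro b hb
      rw [Finset.mem_Ico] at hb
      exact ⟨(b - ((x - v) + e : ℕ)).toNat, by rw [Finset.mem_range]; omega, by omega⟩
    · intro l hl
      rw [Finset.mem_range] at hl
      congr 1
      omega
  rw [hsum]
  unfold greenGlue antidiagSum
  split_ifs with h
  -- Here `x ≤ v`. Beyond the first `r + 1` terms the range is either empty (`r = w - v`) or
  -- symmetric under the reflection (`r = x`).
  · rw [← Finset.Ico_union_Ico_eq_Ico (b := (((x - v) + e + r + 1 : ℕ) : ℤ)) (by omega) (by omega),
      Finset.sum_union (Finset.Ico_disjoint_Ico_consecutive _ _ _)]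
    rw [sum_reflect_eq_zero hD hD' (Finset.Ico (((x - v) + e + r + 1 : ℕ) : ℤ) _) _ fun b hb => ?_,
      add_zero]
    · congr 2; omega
    · rw [Finset.mem_Ico] at hb ⊢
      left; omega
  · rw [← Finset.sum_neg_distrib]
    rw [Finset.sum_congr rfl fun b _ => (hD' b _).symm]
    -- For `x > v`, reflecting the range turns the second branch into the same shape; the excess is
    -- then empty (`r = v`) or symmetric (`r = w - x`).
    have : ∑ b ∈ Finset.Ico ((w : ℤ) - v + e + 1) (w + e + 2),
        D b ((w : ℤ) - v + e + (x + e + 1) - b) =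
        ∑ b ∈ Finset.Ico ((x : ℤ) - v + e) (x + e + 1),
          D ((w : ℤ) - v + e + (x + e + 1) - b) b := by
      refine Finset.sum_bij (fun b _ => (w : ℤ) - v + e + (x + e + 1) - b) ?_ ?_ ?_ ?_
      · intro b hb
        rw [Finset.mem_Ico] at hb ⊢; omega
      · intro a _ b _ h; omega
      · intro b hb
        rw [Finset.mem_Ico] at hb
        exact ⟨(w : ℤ) - v + e + (x + e + 1) - b, by rw [Finset.mem_Ico]; omega, by omega⟩
      · intro b _
        congr 1
        ring
    rw [this, ← Finset.Ico_union_Ico_eq_Ico (b := (((x - v) + e + r + 1 : ℕ) : ℤ)) (by omega)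
      (by omega), Finset.sum_union (Finset.Ico_disjoint_Ico_consecutive _ _ _)]
    rw [sum_reflect_eq_zero hD hD' (Finset.Ico (((x - v) + e + r + 1 : ℕ) : ℤ) _) _ fun b hb => ?_,
      add_zero]
    · congr 2; omega
    · rw [Finset.mem_Ico] at hb ⊢
      left; omega
end

/-! ### Alternants with two free rows. -/

/-- Row exponents of the alternant of the partition `(w ^ (α - 1), x, y, 0 ^ (β - 1))`, where the
exponents `a` and `b` of the two middle rows are arbitrary. -/
def middleExp (α β w a b : ℕ) (i : Fin (α + β)) : ℕ :=
  if (i : ℕ) + 1 < α then w + (α + β - 1 - i) else if (i : ℕ) + 1 = α then a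
  else if (i : ℕ) = α then b else α + β - 1 - i

/-- The alternant with row exponents `middleExp`, as a function of the two middle exponents. -/
noncomputable def middleAlternant (α β w : ℕ) (a b : ℤ) : MvPolynomial (Fin (α + β)) ℤ :=
  Matrix.det (Matrix.of fun i j : Fin (α + β) =>
    (MvPolynomial.X j : MvPolynomial (Fin (α + β)) ℤ) ^ middleExp α β w a.toNat b.toNat i)

theorem middleAlternant_eq_zero_of_row {α β w : ℕ} {a b : ℤ} {i i' : Fin (α + β)} (hi : i ≠ i')
    (h : middleExp α β w a.toNat b.toNat i = middleExp α β w a.toNat b.toNat i') :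
    middleAlternant α β w a b = 0 :=
  Matrix.det_zero_of_row_eq hi (by ext1 j; simp [h])

section
variable {α β : ℕ} (hα : 0 < α) (hβ : 0 < β) (w : ℕ)
include hα hβ

theorem middleAlternant_self (a : ℤ) : middleAlternant α β w a a = 0 := by
  refine middleAlternant_eq_zero_of_row (i := ⟨α - 1, by omega⟩) (i' := ⟨α, by omega⟩) ?_ ?_
  · simp; omega
  · have : α - 1 + 1 = α := by omega
    simp [middleExp, this]

theorem middleAlternant_swap (a b : ℤ) :
    middleAlternant α β w a b = -middleAlternant α β w b a := by
  have hne : (⟨α - 1, by omega⟩ : Fin (α + β)) ≠ ⟨α, by omega⟩ := by simp; omega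
  have h := Matrix.det_permute (Equiv.swap (⟨α - 1, by omega⟩ : Fin (α + β)) ⟨α, by omega⟩)
    (Matrix.of fun i j : Fin (α + β) =>
    (MvPolynomial.X j : MvPolynomial (Fin (α + β)) ℤ) ^ middleExp α β w b.toNat a.toNat i)
  rw [Equiv.Perm.sign_swap hne] at h
  simp only [Units.val_neg, Units.val_one, Int.cast_neg, Int.cast_one, neg_mul, one_mul] at h
  rw [middleAlternant, middleAlternant, ← h]
  congr 1
  ext1 i j
  simp only [Matrix.of_apply, Matrix.submatrix_apply, id]
  congr 1
  rw [Equiv.swap_apply_def]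
  have h1 : α - 1 + 1 = α := by omega
  have h2 : α - 1 ≠ α := by omega
  split_ifs with h3 h4
  · simp [middleExp, h3, h1]
  · simp [middleExp, h4, h1]
  · simp only [middleExp, Fin.ext_iff] at h3 h4 ⊢
    split_ifs <;> first | rfl | omega

theorem middleAlternant_eq_zero_of_lt {a b : ℤ} (ha : 0 ≤ a) (h : a < β - 1) :
    middleAlternant α β w a b = 0 := by
  -- The rows below the middle pair carry the exponents `β - 2, …, 0`.
  refine middleAlternant_eq_zero_of_row (i := ⟨α - 1, by omega⟩)
    (i' := ⟨α + β - 1 - a.toNat, by omega⟩) ?_ ?_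
  · simp; omega
  · simp only [middleExp]
    split_ifs <;> omega

theorem middleAlternant_eq_zero_of_gt {a b : ℤ} (ha : w + β < a) (h : a < w + α + β) :
    middleAlternant α β w a b = 0 := by
  -- The rows above the middle pair carry the exponents `w + α + β - 1, …, w + β + 1`.
  refine middleAlternant_eq_zero_of_row (i := ⟨α - 1, by omega⟩)
    (i' := ⟨w + α + β - 1 - a.toNat, by omega⟩) ?_ ?_
  · simp; omega
  · simp only [middleExp]
    split_ifs <;> omega
end

/-- The generic monic polynomial `∏ (T - X_i)`. -/
noncomputable def genericPoly (n : ℕ) : Polynomial (MvPolynomial (Fin n) ℤ) :=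
  ∏ i, (Polynomial.X - Polynomial.C (MvPolynomial.X i))

theorem genericPoly_natDegree (n : ℕ) : (genericPoly n).natDegree = n := by
  simp [genericPoly]

theorem genericPoly_coeff_self (n : ℕ) : (genericPoly n).coeff n = 1 := by
  have : (genericPoly n).Monic := Polynomial.monic_prod_of_monic _ _ fun i _ =>
    Polynomial.monic_X_sub_C _
  simpa [Polynomial.Monic, Polynomial.leadingCoeff, genericPoly_natDegree] using this

theorem sum_genericPoly_coeff_mul_pow {n : ℕ} (i : Fin n) (a : ℕ) :
    ∑ j ∈ Finset.range (n + 1), (genericPoly n).coeff j *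
      (MvPolynomial.X i : MvPolynomial (Fin n) ℤ) ^ (a + j) = 0 := by
  have h : (genericPoly n).eval (MvPolynomial.X i) = 0 := by
    rw [genericPoly, Polynomial.eval_prod]
    exact Finset.prod_eq_zero (Finset.mem_univ i) (by simp)
  rw [Polynomial.eval_eq_sum_range, genericPoly_natDegree] at h
  rw [← mul_zero ((MvPolynomial.X i) ^ a), ← h, Finset.mul_sum]
  exact Finset.sum_congr rfl fun j _ => by ring

theorem middleAlternant_eq_updateRow {α β : ℕ} (hα : 0 < α) (w : ℕ) (a b : ℤ) :
    middleAlternant α β w a b = ((Matrix.of fun i j : Fin (α + β) =>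
      (MvPolynomial.X j : MvPolynomial (Fin (α + β)) ℤ) ^ middleExp α β w 0 b.toNat i).updateRow
        ⟨α - 1, by omega⟩ fun j => MvPolynomial.X j ^ a.toNat).det := by
  rw [middleAlternant]
  congr 1
  ext1 i j
  rw [Matrix.updateRow_apply]
  have h1 : α - 1 + 1 = α := by omega
  split_ifs with h
  · simp [middleExp, h, h1]
  · simp only [Matrix.of_apply]
    congr 1
    simp only [middleExp, Fin.ext_iff] at h ⊢
    split_ifs <;> first | rfl | omega

/-- The determinant is linear in the row `X_j ^ a`, and every `X_j` is a root of `∏ (T - X_i)`. -/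
theorem middleAlternant_recurrence {α β : ℕ} (hα : 0 < α) (w : ℕ) {a : ℤ} (b : ℤ) (ha : 0 ≤ a) :
    ∑ j ∈ Finset.range (α + β + 1), (genericPoly (α + β)).coeff j *
      middleAlternant α β w (a + j) b = 0 := by
  simp only [middleAlternant_eq_updateRow hα]
  set M := (Matrix.of fun i j : Fin (α + β) =>
      (MvPolynomial.X j : MvPolynomial (Fin (α + β)) ℤ) ^ middleExp α β w 0 b.toNat i)
  let f := (Matrix.detRowAlternating (R := MvPolynomial (Fin (α + β)) ℤ)
    (n := Fin (α + β))).toMultilinearMap.toLinearMap M ⟨α - 1, by omega⟩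
  have hf : ∀ r, (M.updateRow ⟨α - 1, by omega⟩ r).det = f r := fun r => rfl
  simp only [hf, ← smul_eq_mul, ← map_smul, ← map_sum]
  convert map_zero f
  ext1 i
  simp only [Finset.sum_apply, Pi.smul_apply, smul_eq_mul, Pi.zero_apply]
  rw [← sum_genericPoly_coeff_mul_pow i a.toNat]
  refine Finset.sum_congr rfl fun j _ => ?_
  congr 2
  omega

theorem alternant_twoRowEnd {α β : ℕ} (hβ : 0 < β) (w x y : ℕ) :
    alternant (twoRowEnd α β w x y) =
      middleAlternant α β w ((x + (β - 1 + 1) : ℕ)) ((y + (β - 1) : ℕ)) := by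
  rw [alternant, middleAlternant]
  congr 1
  ext1 i j
  simp only [Matrix.of_apply, twoRowEnd, middleExp]
  congr 1
  split_ifs <;> omega

/-- One sign comes from exchanging the middle rows; the other, `(-1) ^ (α - 1)`, from cycling the
row of exponent `w + α + β` to the top of the first `α` rows. -/
theorem middleAlternant_pole {α β : ℕ} (hα : 0 < α) (hβ : 0 < β) (w : ℕ) :
    middleAlternant α β w ((β : ℤ) - 1) (w + (α + β : ℕ)) =
      (-1) ^ α * alternant (rectPart α β (w + 1)) := by
  rw [middleAlternant_swap hα hβ]
  have : NeZero (α + β) := ⟨by omega⟩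
  have h := Matrix.det_permute (Fin.cycleRange (⟨α - 1, by omega⟩ : Fin (α + β)))
    (Matrix.of fun i j : Fin (α + β) => (MvPolynomial.X j : MvPolynomial (Fin (α + β)) ℤ) ^
      (rectPart α β (w + 1) i + (α + β - 1 - (i : ℕ))))
  rw [Fin.sign_cycleRange] at h
  have hα' : (-1 : MvPolynomial (Fin (α + β)) ℤ) ^ α = - (-1) ^ (α - 1) := by
    obtain ⟨k, rfl⟩ : ∃ k, α = k + 1 := ⟨α - 1, by omega⟩
    simp [pow_succ]
  rw [hα', neg_mul, neg_inj, alternant]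
  push_cast at h
  rw [← h, middleAlternant]
  congr 1
  ext1 i j
  simp only [Matrix.of_apply, Matrix.submatrix_apply, id]
  congr 1
  have hc : ((Fin.cycleRange (⟨α - 1, by omega⟩ : Fin (α + β)) i : Fin (α + β)) : ℕ) =
      if (i : ℕ) < α - 1 then (i : ℕ) + 1 else if (i : ℕ) = α - 1 then 0 else i := by
    split_ifs with h1 h2
    · rw [Fin.coe_cycleRange_of_lt (by exact h1)]
    · rw [Fin.cycleRange_of_eq (Fin.ext h2)]; simp
    · rw [Fin.cycleRange_of_gt]; show α - 1 < (i : ℕ); omega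
  simp only [rectPart, middleExp, hc]
  split_ifs <;> omega

/-! ### Schur sums invert the band Toeplitz matrix. -/

/-- The sum of Schur polynomials in the numerator of the generating function. -/
noncomputable def schurSum (α β w x v : ℕ) : MvPolynomial (Fin (α + β)) ℤ :=
  ∑ l ∈ Finset.range (min (min x v) (min (w - x) (w - v)) + 1),
    schurPoly (twoRowEnd α β w (w - (v - x) - l) ((x - v) + l))

theorem alternant_mul_schurSum {α β : ℕ} (hα : 0 < α) (hβ : 0 < β) {w x v : ℕ} (hv : v ≤ w)
    (hx : x ≤ w) : alternant 0 * schurSum α β w x v =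
      greenGlue (middleAlternant α β w) ((β - 1 : ℕ) : ℤ) w v (x + ((β - 1 : ℕ) : ℤ) + 1) := by
  rw [greenGlue_eq_sum (middleAlternant_self hα hβ w) (middleAlternant_swap hα hβ w) hv hx,
    schurSum, Finset.mul_sum]
  refine Finset.sum_congr rfl fun l _ => ?_
  rw [alternant_zero_mul_schurPoly, alternant_twoRowEnd hβ]

theorem schurSum_recurrence {α β : ℕ} (hα : 0 < α) (hβ : 0 < β) {w u v : ℕ} (hu : u ≤ w)
    (hv : v ≤ w) :
    ∑ x ∈ Finset.range (w + 1), (if u ≤ x + β then (genericPoly (α + β)).coeff (x + β - u) else 0) *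
      schurSum α β w x v = if u = v then (-1) ^ α * schurPoly (rectPart α β (w + 1)) else 0 := by
  refine mul_left_cancel₀ (alternant_zero_ne_zero (n := α + β)) ?_
  have key := greenGlue_recurrence (D := middleAlternant α β w) (n := α + β)
    (E := ((β - 1 : ℕ) : ℤ)) (w := w) (v := v) (u := u) (k := (genericPoly (α + β)).coeff)
    (middleAlternant_self hα hβ w) (middleAlternant_swap hα hβ w)
    (fun a b h1 h2 => middleAlternant_eq_zero_of_lt hα hβ w h1 (by omega))
    (fun a b h1 h2 => middleAlternant_eq_zero_of_gt hα hβ w (by omega) (by push_cast at h2; omega))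
    (fun a b ha => middleAlternant_recurrence hα w b ha)
    (genericPoly_coeff_self _) (by omega) (by omega) (by omega) (by push_cast; omega) (by omega)
  have e1 : (((β - 1 : ℕ) : ℤ)) = (β : ℤ) - 1 := by omega
  have rhs : alternant 0 * (if u = v then (-1) ^ α * schurPoly (rectPart α β (w + 1)) else 0) =
      if (u : ℤ) = v then middleAlternant α β w ((β - 1 : ℕ) : ℤ) (w + (α + β : ℕ)) else 0 := by
    simp only [Nat.cast_inj]
    rw [e1, middleAlternant_pole hα hβ, ← alternant_zero_mul_schurPoly (rectPart α β (w + 1))]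
    split_ifs <;> ring
  rw [rhs, ← key, Finset.mul_sum]
  symm
  -- The sums are matched by `u + j = x + β`. Unmatched `j` hit boundary zeros of `greenGlue`;
  -- unmatched `x` lie outside the band.
  rw [← Finset.sum_filter_of_ne (p := fun j => β ≤ u + j ∧ u + j ≤ w + β)]
  · rw [← Finset.sum_filter_of_ne (s := Finset.range (w + 1))
      (p := fun x => u ≤ x + β ∧ x + β ≤ u + (α + β))]
    · refine Finset.sum_bij (fun j _ => u + j - β) ?_ ?_ ?_ ?_
      · intro j hj
        simp only [Finset.mem_filter, Finset.mem_range] at hj ⊢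
        omega
      · intro j hj j' hj' h
        simp only [Finset.mem_filter, Finset.mem_range] at hj hj'
        omega
      · intro x hx
        simp only [Finset.mem_filter, Finset.mem_range] at hx
        exact ⟨x + β - u, by simp only [Finset.mem_filter, Finset.mem_range]; omega, by omega⟩
      · intro j hj
        simp only [Finset.mem_filter, Finset.mem_range] at hj
        rw [if_pos (by omega), mul_left_comm, alternant_mul_schurSum hα hβ hv (by omega)]
        congr 2 <;> omega
    · intro x _ hne
      by_contra hcon
      refine hne ?_
      split_ifs with h
      · rw [Polynomial.coeff_eq_zero_of_natDegree_lt (by rw [genericPoly_natDegree]; omega)]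
        simp
      · simp
  · intro j hj hne
    rw [Finset.mem_range] at hj
    by_contra hcon
    refine hne ?_
    rw [greenGlue_eq_zero (n := α + β) (middleAlternant_self hα hβ w) (middleAlternant_swap hα hβ w)
      (fun a b h1 h2 => middleAlternant_eq_zero_of_lt hα hβ w h1 (by omega))
      (fun a b h1 h2 => middleAlternant_eq_zero_of_gt hα hβ w (by omega)
        (by push_cast at h2; omega)) (by omega) (by omega) (by omega), mul_zero]

/-! ### First-step decomposition of paths. -/

/-- The weight of a step `s`, extended by zero outside the step set. -/
def stepEntry {F : Type*} [Zero F] (S : Finset ℤ) (p q : ℕ → F) (s : ℤ) : F :=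
  if s ∈ S then stepWeight p q s else 0

theorem mem_slitPaths {S : Finset ℤ} {w u v n : ℕ} {h : Fin (n + 1) → Fin (w + 1)} :
    h ∈ slitPaths S w u v n ↔ (h 0 : ℕ) = u ∧ (h (Fin.last n) : ℕ) = v ∧
      ∀ i : Fin n, ((h i.succ : ℕ) : ℤ) - ((h i.castSucc : ℕ) : ℤ) ∈ S := by
  simp [slitPaths]

theorem sum_slitPaths_succ {F : Type*} [Field F] (S : Finset ℤ) (p q : ℕ → F) {w u : ℕ}
    (hu : u ≤ w) (v n : ℕ) :
    ∑ h ∈ slitPaths S w u v (n + 1), pathWeight p q h =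
      ∑ x : Fin (w + 1), stepEntry S p q ((x : ℕ) - (u : ℤ)) *
        ∑ h ∈ slitPaths S w x v n, pathWeight p q h := by
  rw [← Finset.sum_fiberwise _ (fun h => h 1)]
  refine Finset.sum_congr rfl fun x _ => ?_
  by_cases hx : ((x : ℕ) : ℤ) - u ∈ S
  · rw [Finset.mul_sum]
    refine Finset.sum_bij' (fun h _ => Fin.tail h)
      (fun h _ => (Fin.cons ⟨u, by omega⟩ h : Fin (n + 2) → Fin (w + 1))) ?_ ?_ ?_ ?_ ?_
    · intro h hh
      rw [Finset.mem_filter, mem_slitPaths] at hh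
      obtain ⟨⟨_, h2, h3⟩, h4⟩ := hh
      rw [mem_slitPaths]
      refine ⟨by rw [← h4]; rfl, h2, fun i => h3 i.succ⟩
    · intro h hh
      rw [mem_slitPaths] at hh
      obtain ⟨h1, h2, h3⟩ := hh
      rw [Finset.mem_filter, mem_slitPaths]
      refine ⟨⟨rfl, h2, fun i => ?_⟩, Fin.ext h1⟩
      refine Fin.cases ?_ (fun i => h3 i) i
      simpa [h1] using hx
    · intro h hh
      rw [Finset.mem_filter, mem_slitPaths] at hh
      convert Fin.cons_self_tail h
      exact hh.1.1.symm
    · intro h _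
      exact Fin.tail_cons _ _
    · intro h hh
      rw [Finset.mem_filter, mem_slitPaths] at hh
      obtain ⟨⟨h1, _, _⟩, h4⟩ := hh
      rw [pathWeight, Fin.prod_univ_succ, stepEntry, if_pos hx, ← h4, ← h1]
      rfl
  · rw [stepEntry, if_neg hx, zero_mul]
    refine Finset.sum_eq_zero fun h hh => ?_
    rw [Finset.mem_filter, mem_slitPaths] at hh
    obtain ⟨⟨h1, _, h3⟩, h4⟩ := hh
    refine absurd (h3 0) ?_
    rw [← h4, ← h1] at hx
    exact hx

theorem slitGF_eq {F : Type*} [Field F] (S : Finset ℤ) (p q : ℕ → F) {w u : ℕ}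
    (hu : u ≤ w) (v : ℕ) :
    slitGF S p q w u v = (if u = v then 1 else 0) + PowerSeries.X *
      ∑ x : Fin (w + 1), PowerSeries.C (stepEntry S p q ((x : ℕ) - (u : ℤ))) *
        slitGF S p q w x v := by
  ext n
  cases n with
  | zero =>
    simp only [slitGF, PowerSeries.coeff_mk, map_add, PowerSeries.coeff_zero_X_mul, add_zero]
    by_cases h : u = v
    · subst h
      have : slitPaths S w u u 0 = {fun _ => ⟨u, by omega⟩} := by
        ext h
        simp only [mem_slitPaths, Finset.mem_singleton]
        constructor
        · rintro ⟨h1, _, _⟩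
          funext i
          obtain rfl : i = 0 := Fin.ext (by omega)
          exact Fin.ext h1
        · rintro rfl
          exact ⟨rfl, rfl, fun i => i.elim0⟩
      rw [this]
      simp [pathWeight]
    · have : slitPaths S w u v 0 = ∅ := by
        ext h'
        simp only [mem_slitPaths, Finset.notMem_empty, iff_false]
        rintro ⟨h1, h2, _⟩
        exact h (h1.symm.trans h2)
      rw [this]
      simp [h]
  | succ n =>
    simp only [slitGF, PowerSeries.coeff_mk, map_add, PowerSeries.coeff_succ_X_mul, map_sum,
      PowerSeries.coeff_C_mul]
    rw [sum_slitPaths_succ S p q hu]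
    split_ifs <;> simp [PowerSeries.coeff_one]

/-! ### Coefficients and factorization of the kernel. -/

theorem mem_upSteps {S : Finset ℤ} {a : ℕ} : a ∈ upSteps S ↔ (a : ℤ) ∈ S := by
  simp only [upSteps, Finset.mem_image, Finset.mem_filter]
  constructor
  · rintro ⟨s, ⟨h1, h2⟩, rfl⟩
    rwa [Int.natAbs_of_nonneg h2]
  · exact fun h => ⟨(a : ℤ), ⟨h, Int.natCast_nonneg a⟩, by simp⟩

theorem mem_downSteps {S : Finset ℤ} {b : ℕ} : b ∈ downSteps S ↔ 0 < b ∧ (-b : ℤ) ∈ S := by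
  simp only [downSteps, Finset.mem_image, Finset.mem_filter]
  constructor
  · rintro ⟨s, ⟨h1, h2⟩, rfl⟩
    exact ⟨by omega, by rwa [show -((s.natAbs : ℕ) : ℤ) = s by omega]⟩
  · exact fun h => ⟨-b, ⟨h.2, by have := h.1; omega⟩, by simp⟩

theorem kernelPoly_coeff {L : Type*} [Field L] (S : Finset ℤ) (p q : ℕ → L) {β : ℕ}
    (hβ : ∀ b ∈ downSteps S, b ≤ β) (t : L) (k : ℕ) :
    (kernelPoly S p q β t).coeff k =
      (if k = β then 1 else 0) - t * stepEntry S p q ((k : ℤ) - β) := by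
  have hup : ∑ a ∈ upSteps S, (if k = a + β then p a else 0) =
      if β ≤ k ∧ k - β ∈ upSteps S then p (k - β) else 0 := by
    split_ifs with h
    · rw [Finset.sum_eq_single_of_mem _ h.2 fun a _ ha => if_neg (by omega), if_pos (by omega)]
    · refine Finset.sum_eq_zero fun a ha => if_neg ?_
      rintro rfl
      exact h ⟨by omega, by simpa using ha⟩
  have hdown : ∑ b ∈ downSteps S, (if k = β - b then q b else 0) =
      if k ≤ β ∧ β - k ∈ downSteps S then q (β - k) else 0 := by
    split_ifs with h
    · rw [Finset.sum_eq_single_of_mem _ h.2 fun b hb hne => if_neg ?_, if_pos (by omega)]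
      have := hβ b hb
      omega
    · refine Finset.sum_eq_zero fun b hb => if_neg ?_
      rintro rfl
      have := hβ b hb
      exact h ⟨by omega, by rwa [show β - (β - b) = b by omega]⟩
  simp only [kernelPoly, Polynomial.coeff_sub, Polynomial.coeff_X_pow, Polynomial.coeff_C_mul,
    Polynomial.finsetSum_coeff, mul_ite, mul_one, mul_zero, hup, hdown]
  rw [sub_sub, ← mul_ite_zero, ← mul_ite_zero, ← mul_add]
  congr 2
  simp only [mem_upSteps, mem_downSteps, stepEntry, stepWeight]
  rcases le_or_gt β k with h | h
  · rw [show ((k - β : ℕ) : ℤ) = (k : ℤ) - β by omega, if_neg (c := k ≤ β ∧ _) (by omega),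
      if_pos (c := (0 : ℤ) ≤ _) (by omega), show ((k : ℤ) - β).natAbs = k - β by omega]
    simp [h]
  · rw [if_neg (by omega), if_neg (c := (0 : ℤ) ≤ _) (by omega),
      show -((β - k : ℕ) : ℤ) = (k : ℤ) - β by omega, show ((k : ℤ) - β).natAbs = β - k by omega]
    simp [h, h.le]

theorem kernelPoly_eq {L : Type*} [Field L] {S : Finset ℤ} {p q : ℕ → L} {α β : ℕ}
    (hα : IsGreatest (upSteps S : Set ℕ) α) (hβ : ∀ b ∈ downSteps S, b ≤ β)
    (hα0 : 0 < α) {t : L} (ht : t ≠ 0) (hp : p α ≠ 0) {z : Fin (α + β) → L}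
    (hz : IsKernelRoots S p q α β t z) :
    kernelPoly S p q β t = Polynomial.C (-(t * p α)) *
      (genericPoly (α + β)).map (MvPolynomial.aeval (R := ℤ) z : _ →+* L) := by
  have htop : (kernelPoly S p q β t).coeff (α + β) = -(t * p α) := by
    rw [kernelPoly_coeff S p q hβ, if_neg (by omega), stepEntry]
    have := mem_upSteps.1 hα.1
    simp [this, stepWeight]
  have hdeg : (kernelPoly S p q β t).natDegree = α + β := by
    refine le_antisymm ?_ (Polynomial.le_natDegree_of_ne_zero ?_)
    · refine Polynomial.natDegree_le_iff_coeff_eq_zero.2 fun N hN => ?_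
      rw [kernelPoly_coeff S p q hβ, if_neg (by omega), stepEntry, if_neg, mul_zero, sub_zero]
      intro hmem
      have h2 : N - β ≤ α := hα.2 (mem_upSteps.2 (by
        rwa [show ((N - β : ℕ) : ℤ) = (N : ℤ) - β by omega]))
      omega
    · rw [htop]
      exact neg_ne_zero.2 (mul_ne_zero ht hp)
  -- The list `z` has as many entries as the degree, so the polynomial splits.
  have hcard : Multiset.card (kernelPoly S p q β t).roots = (kernelPoly S p q β t).natDegree := by
    rw [hz, hdeg]; simp
  rw [← Polynomial.C_leadingCoeff_mul_prod_multiset_X_sub_C hcard, Polynomial.leadingCoeff, hdeg,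
    htop, hz, genericPoly, Polynomial.map_prod]
  simp only [Polynomial.map_sub, Polynomial.map_X, Polynomial.map_C, RingHom.coe_coe,
    MvPolynomial.aeval_X, Multiset.map_map]
  rfl

theorem schurPoly_rectPart_zero (α β : ℕ) : schurPoly (rectPart α β 0) = 1 := by
  refine mul_left_cancel₀ (alternant_zero_ne_zero (n := α + β)) ?_
  rw [alternant_zero_mul_schurPoly, mul_one]
  congr 1
  ext1 i
  simp [rectPart]

theorem schurSum_self_self {α β : ℕ} (w : ℕ) :
    schurSum α β w w w = schurPoly (rectPart α β w) := by
  have : twoRowEnd α β w w 0 = rectPart α β w := by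
    ext1 i
    simp only [twoRowEnd, rectPart]
    split_ifs <;> omega
  simp [schurSum, this]

/-! ### Comparison of the two inverses. -/

section
variable {F : Type*} [Field F] {S : Finset ℤ} {p q : ℕ → F} {α β : ℕ} {L : Type*} [Field L]
  {ι : PowerSeries F →+* L} {z : Fin (α + β) → L}

/-- The Schur sums are a scalar multiple of the inverse of the transfer matrix `1 - tA`. -/
theorem aeval_schurSum_eq (hα : IsGreatest (upSteps S : Set ℕ) α)
    (hβ : IsGreatest (downSteps S : Set ℕ) β) (hα0 : 0 < α) (hp : p α ≠ 0)
    (hι : Function.Injective ι)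
    (hz : IsKernelRoots S (fun a => ι (PowerSeries.C (p a))) (fun b => ι (PowerSeries.C (q b)))
      α β (ι PowerSeries.X) z) {w u v : ℕ} (hu : u ≤ w) (hv : v ≤ w) :
    MvPolynomial.aeval z (schurSum α β w u v) =
      -(ι PowerSeries.X * ι (PowerSeries.C (p α))) * ((-1) ^ α *
        MvPolynomial.aeval z (schurPoly (rectPart α β (w + 1)))) * ι (slitGF S p q w u v) := by
  have hβ0 : 0 < β := (mem_downSteps.1 hβ.1).1
  have ht : ι PowerSeries.X ≠ 0 := (map_ne_zero_iff ι hι).2 PowerSeries.X_ne_zero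
  have hp' : ι (PowerSeries.C (p α)) ≠ 0 :=
    (map_ne_zero_iff ι hι).2 ((map_ne_zero_iff _ PowerSeries.C_injective).2 hp)
  have hK := kernelPoly_eq hα (fun b hb => hβ.2 hb) hα0 ht hp' hz
  set c := -(ι PowerSeries.X * ι (PowerSeries.C (p α))) with hc
  let M : Matrix (Fin (w + 1)) (Fin (w + 1)) L := Matrix.of fun u x =>
    (if u = x then 1 else 0) - ι PowerSeries.X *
      ι (PowerSeries.C (stepEntry S p q (((x : ℕ) : ℤ) - (u : ℕ))))
  let G : Matrix (Fin (w + 1)) (Fin (w + 1)) L := Matrix.of fun u v => ι (slitGF S p q w u v)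
  let H : Matrix (Fin (w + 1)) (Fin (w + 1)) L := Matrix.of fun u v =>
    MvPolynomial.aeval z (schurSum α β w u v)
  have hMG : M * G = 1 := by
    ext u v
    have h := congrArg ι (slitGF_eq S p q (Nat.lt_succ_iff.1 u.2) v)
    simp only [map_add, map_mul, map_sum] at h
    simp only [M, G, Matrix.mul_apply, Matrix.of_apply, sub_mul, Finset.sum_sub_distrib, ite_mul,
      one_mul, zero_mul, Finset.sum_ite_eq, Finset.mem_univ, if_true, Matrix.one_apply]
    rw [h, Finset.mul_sum]
    simp only [mul_assoc, add_sub_cancel_right, Fin.ext_iff]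
    split_ifs <;> simp
  have hM : ∀ u x : Fin (w + 1), M u x = c * MvPolynomial.aeval z
      (if (u : ℕ) ≤ x + β then (genericPoly (α + β)).coeff (x + β - u) else 0) := fun u x => by
    have hs : ∀ s, ι (PowerSeries.C (stepEntry S p q s)) = stepEntry S
        (fun a => ι (PowerSeries.C (p a))) (fun b => ι (PowerSeries.C (q b))) s := fun s => by
      simp only [stepEntry, stepWeight]
      split_ifs <;> simp
    simp only [M, Matrix.of_apply, hs]
    split_ifs with h1 h2 h2
    all_goals try omega
    · have h3 := congrArg (fun P => Polynomial.coeff P ((x : ℕ) + β - u)) hK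
      simp only [Polynomial.coeff_C_mul, Polynomial.coeff_map,
        kernelPoly_coeff _ _ _ (fun b hb => hβ.2 hb)] at h3
      rw [if_pos (by omega),
        show (((x : ℕ) + β - (u : ℕ) : ℕ) : ℤ) - β = ((x : ℕ) : ℤ) - (u : ℕ) by omega] at h3
      exact h3
    · have h3 := congrArg (fun P => Polynomial.coeff P ((x : ℕ) + β - u)) hK
      simp only [Polynomial.coeff_C_mul, Polynomial.coeff_map,
        kernelPoly_coeff _ _ _ (fun b hb => hβ.2 hb)] at h3
      rw [if_neg (by omega),
        show (((x : ℕ) + β - (u : ℕ) : ℕ) : ℤ) - β = ((x : ℕ) : ℤ) - (u : ℕ) by omega] at h3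
      exact h3
    -- Below the band `u - x` exceeds `β`, so no step leads from `u` to `x`.
    · rw [stepEntry, if_neg]
      · simp
      · intro hmem
        have : (u : ℕ) - x ≤ β := hβ.2 (mem_downSteps.2 ⟨by omega, by
          rwa [show -(((u : ℕ) - (x : ℕ) : ℕ) : ℤ) = ((x : ℕ) : ℤ) - (u : ℕ) by omega]⟩)
        omega
  have hMH : M * H = (c * ((-1) ^ α * MvPolynomial.aeval z
      (schurPoly (rectPart α β (w + 1))))) • (1 : Matrix (Fin (w + 1)) (Fin (w + 1)) L) := by
    ext u v
    have h := congrArg (MvPolynomial.aeval z) (schurSum_recurrence hα0 hβ0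
      (Nat.lt_succ_iff.1 u.2) (Nat.lt_succ_iff.1 v.2))
    rw [map_sum, Finset.sum_range] at h
    simp only [map_mul] at h
    simp only [Matrix.mul_apply, hM, H, Matrix.of_apply, mul_assoc, ← Finset.mul_sum, h,
      Matrix.smul_apply, Matrix.one_apply, Fin.ext_iff]
    split_ifs <;> simp
  have hH : H = (c * ((-1) ^ α * MvPolynomial.aeval z
      (schurPoly (rectPart α β (w + 1))))) • G := by
    -- For square matrices the right inverse `G` of `M` is also a left inverse.
    rw [← one_mul H, ← mul_eq_one_comm.1 hMG, mul_assoc, hMH, Matrix.mul_smul, mul_one]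
  exact congrFun (congrFun hH ⟨u, by omega⟩) ⟨v, by omega⟩

/-- At `u = v = w` the comparison writes the Schur value of `(w^α, 0^β)` as a multiple of that of
`((w+1)^α, 0^β)`, so if the latter vanished, so would the former. -/
theorem aeval_schurPoly_rectPart_ne_zero (hα : IsGreatest (upSteps S : Set ℕ) α)
    (hβ : IsGreatest (downSteps S : Set ℕ) β) (hα0 : 0 < α) (hp : p α ≠ 0)
    (hι : Function.Injective ι)
    (hz : IsKernelRoots S (fun a => ι (PowerSeries.C (p a))) (fun b => ι (PowerSeries.C (q b)))
      α β (ι PowerSeries.X) z) (w : ℕ) :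
    MvPolynomial.aeval z (schurPoly (rectPart α β w)) ≠ 0 := by
  induction w with
  | zero => simp [schurPoly_rectPart_zero]
  | succ w ih =>
    intro h
    refine ih ?_
    rw [← schurSum_self_self, aeval_schurSum_eq hα hβ hα0 hp hι hz le_rfl le_rfl, h]
    simp
end

theorem corollary1 {F : Type*} [Field F] (S : Finset ℤ) (p q : ℕ → F) (α β : ℕ)
    (hα : IsGreatest (upSteps S : Set ℕ) α) (hβ : IsGreatest (downSteps S : Set ℕ) β)
    (hα0 : 0 < α) (hp : p α ≠ 0) (hq : q β ≠ 0)
    (w u v : ℕ) (hu : u ≤ w) (hv : v ≤ w)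
    {L : Type*} [Field L] (ι : PowerSeries F →+* L) (hι : Function.Injective ι)
    (z : Fin (α + β) → L)
    (hz : IsKernelRoots S (fun a => ι (PowerSeries.C (p a))) (fun b => ι (PowerSeries.C (q b)))
      α β (ι PowerSeries.X) z) :
    MvPolynomial.aeval z (schurPoly (rectPart α β (w + 1))) ≠ 0 ∧
    ι (slitGF S p q w u v) =
      (-1 : L) ^ (1 - (α : ℤ)) * (1 / (ι PowerSeries.X * ι (PowerSeries.C (p α)))) *
        ((∑ l ∈ Finset.range (min (min u v) (min (w - u) (w - v)) + 1),
            MvPolynomial.aeval z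
              (schurPoly (twoRowEnd α β w (w - (v - u) - l) ((u - v) + l)))) /
          MvPolynomial.aeval z (schurPoly (rectPart α β (w + 1)))) := by
  have hs := aeval_schurPoly_rectPart_ne_zero hα hβ hα0 hp hι hz (w + 1)
  refine ⟨hs, ?_⟩
  have ht : ι PowerSeries.X ≠ 0 := (map_ne_zero_iff ι hι).2 PowerSeries.X_ne_zero
  have hp' : ι (PowerSeries.C (p α)) ≠ 0 :=
    (map_ne_zero_iff ι hι).2 ((map_ne_zero_iff _ PowerSeries.C_injective).2 hp)
  have h := aeval_schurSum_eq hα hβ hα0 hp hι hz hu hv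
  rw [schurSum, map_sum] at h
  rw [h, zpow_sub₀ (by simp), zpow_one, zpow_natCast]
  have h1 : ((-1 : L) ^ α) ≠ 0 := pow_ne_zero _ (by simp)
  field_simp
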